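/- An orientation of a finite simple graph $G$ assigns to every edge of $G$ exactly one of its two directions. Let $K_3^{\circlearrowright}$ denote the cyclically oriented triangle, with arcs $a\to b$, $b\to c$, $c\to a$ on three distinct vertices $a,b,c$. Let $D(G,K_3^{\circlearrowright})$ be the number of orientations of $G$ (on its given, labelled vertex set) that contain no copy of $K_3^{\circlearrowright}$, and let $D(n,K_3^{\circlearrowright})$ be the maximum of $D(G,K_3^{\circlearrowright})$ over all simple graphs $G$ with $n$ vertices. Theorem 1.3. For every integer $n\ge 8$, $$D(n,K_3^{\circlearrowright}) = 2^{\lfloor n^2/4\rfloor}.$$ Furthermore, for every simple graph $G$ with $n$ vertices, $D(G,K_3^{\circlearrowright}) = 2^{\lfloor n^2/4\rfloor}$ if and only if $G$ is isomorphic to the complete bipartite graph $K_{\lfloor n/2\rfloor,\lceil n/2\rceil}$. In particular, for every $n\ge 8$, $$D(n,K_3^{\circlearrowright}) = \max\{2^{\lfloor n^2/4\rfloor},\, n!\},$$ which is the equality conjectured by Alon and Yuster. -/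

import Mathlib

/-- `D` is an orientation of the simple graph `G`: the arcs of `D` are edges of `G`, and every edge
of `G` is given exactly one of its two directions. -/
structure SimpleGraph.IsOrientation {V : Type*} (G : SimpleGraph V) (D : Digraph V) : Prop where
  adj_of_arc : ∀ u v : V, D.Adj u v → G.Adj u v
  xor_of_adj : ∀ u v : V, G.Adj u v → Xor (D.Adj u v) (D.Adj v u)

/-- `D` contains a copy of `H`, that is, a (not necessarily induced) subdigraph isomorphic to `H`:
there is an injective map of vertices that sends arcs to arcs. -/
def Digraph.ContainsCopy {V W : Type*} (D : Digraph V) (H : Digraph W) : Prop :=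
  ∃ f : W → V, Function.Injective f ∧ ∀ a b : W, H.Adj a b → D.Adj (f a) (f b)

/-- The set of `H`-free orientations of `G`. -/
def SimpleGraph.freeOrientations {V W : Type*} (G : SimpleGraph V) (H : Digraph W) :
    Set (Digraph V) :=
  {D | G.IsOrientation D ∧ ¬ D.ContainsCopy H}

/-- The number `D(G, H)` of `H`-free orientations of `G` (meant for finite vertex sets). -/
noncomputable def SimpleGraph.numFreeOrientations {V W : Type*} (G : SimpleGraph V)
    (H : Digraph W) : ℕ :=
  (G.freeOrientations H).ncard

/-- The number `D(n, H)`: the maximum of `D(G, H)` over all graphs `G` on `n` labelled vertices. -/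
noncomputable def maxFreeOrientations {W : Type*} (n : ℕ) (H : Digraph W) : ℕ :=
  (Finset.univ : Finset (SimpleGraph (Fin n))).sup' ⟨⊥, Finset.mem_univ _⟩
    (fun G => G.numFreeOrientations H)

/-- The strongly connected triangle, with arcs `0 → 1 → 2 → 0`. -/
def cyclicTriangle : Digraph (Fin 3) where
  Adj a b := b = a + 1

/-! Fix an orientation of all edges away from a vertex. The out-neighbourhood of that vertex must
then be closed under arcs inside its neighbourhood, and for non-adjacent `u` and `v` the two choices
are independent. The count is therefore a sum of products of two numbers of closed sets. By AM-GM,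
cloning `u` over `v` or `v` over `u` in a graph with the most orientations keeps the count maximal
(`two_mul_numFreeOrientations_le`). This Zykov symmetrization leads to a complete multipartite
maximizer, and a prescribed clique survives it (`exists_multipartite_of_forall_le`).

In a triangle-free graph every orientation counts, so Mantel's bound on edges finishes. A complete
multipartite graph with a triangle is treated by induction on the number of vertices, with
`orientationBound` covering the small cases. If some part is a single vertex `x`, then the set `S`
of out-neighbours of `x` forces every edge between `S` and the other vertices, which gives a
binomial convolution (`sum_choose_mul_orientationBound_lt`). Otherwise a vertex of a largest part is
deleted: by `card_closedSubsets_le` its edges have at most `1 + ∑ (2 ^ b i - 1)` orientations, where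
`b i` are the sizes of the other parts, and this is less than `2 ^ (n / 2)`, the ratio of
consecutive values of `2 ^ (n ^ 2 / 4)`.

From eight vertices on, the multipartite bound is strict. Since symmetrization preserves a triangle,
extremal graphs are triangle-free, and uniqueness in Turán's theorem identifies them. -/

open Finset
open scoped Classical

/-! ### Closed vertex sets of a digraph and their number. -/

namespace Digraph

variable {V : Type*}

/-- `D` has no directed closed walk of length three. -/
def IsTriangleAcyclic (D : Digraph V) : Prop :=
  ∀ u v w, D.Adj u v → D.Adj v w → ¬ D.Adj w u

/-- The subdigraph induced on a set of vertices. -/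
def restrict (D : Digraph V) (A : Set V) : Digraph A where
  Adj a b := D.Adj a b

@[simp] lemma restrict_adj (D : Digraph V) (A : Set V) (a b : A) :
    (D.restrict A).Adj a b ↔ D.Adj a b := Iff.rfl

lemma IsTriangleAcyclic.restrict {D : Digraph V} (h : D.IsTriangleAcyclic) (A : Set V) :
    (D.restrict A).IsTriangleAcyclic := fun u v w => h u v w

instance [Finite V] : Finite (Digraph V) := Finite.of_injective _ Digraph.adj_injective

/-- The subsets of `N` that are closed under out-neighbours in `N`. -/
noncomputable def closedSubsets (D : Digraph V) (N : Finset V) : Finset (Finset V) :=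
  {S ∈ N.powerset | ∀ a ∈ S, ∀ b ∈ N, D.Adj a b → b ∈ S}

lemma mem_closedSubsets {D : Digraph V} {N S : Finset V} :
    S ∈ D.closedSubsets N ↔ S ⊆ N ∧ ∀ a ∈ S, ∀ b ∈ N, D.Adj a b → b ∈ S := by
  simp [closedSubsets]

/-- Deleting a vertex `v`: a closed set that avoids `v` avoids all in-neighbours of `v`, and one that
contains `v` contains all out-neighbours of `v`. -/
lemma card_closedSubsets_le_add (D : Digraph V) {N : Finset V} {v : V} (hv : v ∈ N) :
    #(D.closedSubsets N) ≤ #(D.closedSubsets {a ∈ N | a ≠ v ∧ ¬ D.Adj a v}) +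
      #(D.closedSubsets {a ∈ N | a ≠ v ∧ ¬ D.Adj v a}) := by
  rw [← card_filter_add_card_filter_not (s := D.closedSubsets N) (fun S => v ∈ S), add_comm]
  refine Nat.add_le_add (card_le_card fun S hS => ?_)
    (card_le_card_of_injOn (fun S => {a ∈ S | a ≠ v ∧ ¬ D.Adj v a}) (fun S hS => ?_) ?_)
  · simp only [mem_filter, mem_closedSubsets] at hS ⊢
    obtain ⟨⟨h1, h2⟩, h3⟩ := hS
    refine ⟨fun a ha => ?_, fun a ha b hb hab => h2 a ha b hb.1 hab⟩
    refine mem_filter.2 ⟨h1 ha, ?_, fun h => h3 (h2 a ha v hv h)⟩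
    rintro rfl
    exact h3 ha
  · simp only [mem_coe, mem_filter, mem_closedSubsets] at hS ⊢
    obtain ⟨⟨h1, h2⟩, h3⟩ := hS
    refine ⟨fun a ha => ?_, fun a ha b hb hab => ?_⟩
    · simp only [mem_filter] at ha ⊢
      exact ⟨h1 ha.1, ha.2⟩
    · exact ⟨h2 a ha.1 b hb.1 hab, hb.2⟩
  · intro S hS T hT hST
    simp only [mem_coe, mem_filter, mem_closedSubsets] at hS hT
    obtain ⟨⟨h1, h2⟩, h3⟩ := hS
    obtain ⟨⟨k1, k2⟩, k3⟩ := hT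
    ext a
    have := Finset.ext_iff.1 hST a
    simp only [mem_filter] at this
    by_cases ha : a = v
    · subst ha; tauto
    · by_cases hva : D.Adj v a
      · exact ⟨fun h => k2 v k3 a (h1 h) hva, fun h => h2 v h3 a (k1 h) hva⟩
      · tauto

/-- With `x = 2 ^ p - 1` and `y = 2 ^ q - 1` this is `x + y ≤ (x + 1) * (y + 1) - 1`. It serves a
colour class that splits into disjoint pieces. -/
lemma two_pow_sub_one_add_le {p q r : ℕ} (h : p + q ≤ r) :
    (2 ^ p - 1) + (2 ^ q - 1) ≤ 2 ^ r - 1 := by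
  have h1 : 2 ^ (p + q) ≤ 2 ^ r := Nat.pow_le_pow_right (by norm_num) h
  obtain ⟨x, hx⟩ := Nat.exists_eq_add_of_le' (Nat.one_le_two_pow (n := p))
  obtain ⟨y, hy⟩ := Nat.exists_eq_add_of_le' (Nat.one_le_two_pow (n := q))
  rw [pow_add, hx, hy] at h1
  rw [hx, hy]
  have : (x + 1) * (y + 1) = x * y + x + y + 1 := by ring
  have := Nat.zero_le (x * y)
  omega

/-- The number of closed sets when vertices of different colours are always joined by an arc. -/
theorem card_closedSubsets_le {ι : Type*} [Fintype ι] (D : Digraph V) (c : V → ι) (N : Finset V)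
    (h : ∀ a ∈ N, ∀ b ∈ N, c a ≠ c b → D.Adj a b ∨ D.Adj b a) :
    #(D.closedSubsets N) ≤ 1 + ∑ i, (2 ^ #{a ∈ N | c a = i} - 1) := by
  induction hn : #N using Nat.strong_induction_on generalizing N with
  | _ n ih =>
  subst hn
  obtain rfl | ⟨v, hv⟩ := N.eq_empty_or_nonempty
  · simp [closedSubsets]
  · set N₁ : Finset V := {a ∈ N | a ≠ v ∧ ¬ D.Adj a v}
    set N₂ : Finset V := {a ∈ N | a ≠ v ∧ ¬ D.Adj v a}
    have hN₁ : N₁ ⊂ N := filter_ssubset.2 ⟨v, hv, by simp⟩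
    have hN₂ : N₂ ⊂ N := filter_ssubset.2 ⟨v, hv, by simp⟩
    have h₁ := ih _ (card_lt_card hN₁) N₁
      (fun a ha b hb => h a (hN₁.1 ha) b (hN₁.1 hb)) rfl
    have h₂ := ih _ (card_lt_card hN₂) N₂
      (fun a ha b hb => h a (hN₂.1 ha) b (hN₂.1 hb)) rfl
    have key : ∑ i, ((2 ^ #{a ∈ N₁ | c a = i} - 1) + (2 ^ #{a ∈ N₂ | c a = i} - 1)) <
        ∑ i, (2 ^ #{a ∈ N | c a = i} - 1) := by
      have hlt : ∀ M ⊆ N, v ∉ M → #{a ∈ M | c a = c v} + 1 ≤ #{a ∈ N | c a = c v} := by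
        intro M hM hvM
        refine card_lt_card ((ssubset_iff_of_subset (filter_subset_filter _ hM)).2
          ⟨v, by simp [hv], by simp [hvM]⟩)
      -- In the colour of `v` both pieces lose `v`, so the two terms add up to at most `2 ^ r - 2`,
      -- where `r` is the size of the class. The spare unit pays for the second `1 +` coming from
      -- the two induction hypotheses.
      have key' : ((2 ^ #{a ∈ N₁ | c a = c v} - 1) + (2 ^ #{a ∈ N₂ | c a = c v} - 1)) <
          (2 ^ #{a ∈ N | c a = c v} - 1) := by
        have e₁ := hlt N₁ hN₁.1 (by simp [N₁])
        have e₂ := hlt N₂ hN₂.1 (by simp [N₂])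
        have e₃ := Nat.pow_le_pow_right (n := 2) (by norm_num) e₁
        have e₄ := Nat.pow_le_pow_right (n := 2) (by norm_num) e₂
        rw [pow_succ] at e₃ e₄
        have := Nat.one_le_two_pow (n := #{a ∈ N₁ | c a = c v})
        have := Nat.one_le_two_pow (n := #{a ∈ N₂ | c a = c v})
        omega
      refine sum_lt_sum (fun i _ => ?_) ⟨c v, mem_univ _, key'⟩
      by_cases hi : i = c v
      · subst hi; exact key'.le
      -- A vertex of another colour is joined to `v` by an arc, hence is missing from `N₁` or from
      -- `N₂`.
      · refine two_pow_sub_one_add_le ?_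
        rw [← card_union_of_disjoint]
        · exact card_le_card (union_subset (filter_subset_filter _ hN₁.1)
            (filter_subset_filter _ hN₂.1))
        · rw [disjoint_left]
          intro a ha hb
          simp only [N₁, N₂, mem_filter] at ha hb
          have := h a ha.1.1 v hv (by rw [ha.2]; exact hi)
          tauto
    rw [sum_add_distrib] at key
    have : #(D.closedSubsets N) ≤ #(D.closedSubsets N₁) + #(D.closedSubsets N₂) :=
      D.card_closedSubsets_le_add hv
    omega

end Digraph

/-! ### Orientations without cyclic triangles. -/

namespace SimpleGraph

variable {V : Type*}

/-- Injectivity is automatic: any two of the three vertices are joined by an edge of a loopless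
graph. -/
lemma mem_freeOrientations_cyclicTriangle {G : SimpleGraph V} {D : Digraph V} :
    D ∈ G.freeOrientations cyclicTriangle ↔ G.IsOrientation D ∧ D.IsTriangleAcyclic := by
  refine and_congr_right fun hD => ⟨fun h u v w huv hvw hwu => h ?_, ?_⟩
  · have n1 := (hD.adj_of_arc _ _ huv).ne
    have n2 := (hD.adj_of_arc _ _ hvw).ne
    have n3 := (hD.adj_of_arc _ _ hwu).ne
    refine ⟨![u, v, w], ?_, ?_⟩
    · intro i j
      fin_cases i <;> fin_cases j <;> simp [n1, n2, n3, n1.symm, n2.symm, n3.symm]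
    · intro i j hij
      have : j = i + 1 := hij
      subst this
      fin_cases i <;> simpa
  · rintro h ⟨f, -, hf⟩
    exact h _ _ _ (hf 0 1 rfl) (hf 1 2 rfl) (hf 2 0 rfl)

lemma IsOrientation.asymm {G : SimpleGraph V} {D : Digraph V} (h : G.IsOrientation D) {u v : V}
    (huv : D.Adj u v) : ¬ D.Adj v u := by
  have := h.xor_of_adj u v (h.adj_of_arc _ _ huv)
  simp only [Xor] at this
  tauto

lemma IsOrientation.total {G : SimpleGraph V} {D : Digraph V} (h : G.IsOrientation D) {u v : V}
    (huv : G.Adj u v) : D.Adj u v ∨ D.Adj v u := by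
  have := h.xor_of_adj u v huv
  simp only [Xor] at this
  tauto

lemma isOrientation_iff {G : SimpleGraph V} {D : Digraph V} : G.IsOrientation D ↔
    (∀ u v, G.Adj u v ↔ D.Adj u v ∨ D.Adj v u) ∧ ∀ u v, D.Adj u v → ¬ D.Adj v u := by
  refine ⟨fun h => ⟨fun u v => ⟨h.total, ?_⟩, fun u v => h.asymm⟩, fun h => ⟨?_, ?_⟩⟩
  · rintro (h' | h')
    exacts [h.adj_of_arc _ _ h', (h.adj_of_arc _ _ h').symm]
  · exact fun u v huv => (h.1 u v).2 (.inl huv)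
  · intro u v huv
    have h1 := h.2 u v
    have h2 := (h.1 u v).1 huv
    simp only [Xor]
    tauto

/-- The orientations of `G` without cyclic triangles, as a finset. -/
noncomputable def acyclicOrientations [Finite V] (G : SimpleGraph V) : Finset (Digraph V) :=
  (Set.toFinite (G.freeOrientations cyclicTriangle)).toFinset

lemma mem_acyclicOrientations [Finite V] {G : SimpleGraph V} {D : Digraph V} :
    D ∈ G.acyclicOrientations ↔ G.IsOrientation D ∧ D.IsTriangleAcyclic := by
  rw [acyclicOrientations, Set.Finite.mem_toFinset, mem_freeOrientations_cyclicTriangle]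

lemma card_acyclicOrientations [Finite V] (G : SimpleGraph V) :
    #G.acyclicOrientations = G.numFreeOrientations cyclicTriangle :=
  (Set.ncard_eq_toFinset_card _ _).symm

lemma IsOrientation.restrict {G : SimpleGraph V} {D : Digraph V} (h : G.IsOrientation D)
    (A : Set V) : (G.induce A).IsOrientation (D.restrict A) :=
  ⟨fun u v => h.adj_of_arc u v, fun u v => h.xor_of_adj u v⟩

lemma restrict_mem_acyclicOrientations [Finite V] {G : SimpleGraph V} {D : Digraph V}
    (h : D ∈ G.acyclicOrientations) (A : Set V) :
    D.restrict A ∈ (G.induce A).acyclicOrientations := by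
  rw [mem_acyclicOrientations] at h ⊢
  exact ⟨h.1.restrict A, h.2.restrict A⟩

end SimpleGraph

/-! ### Deleting, dominating and cloned vertices. -/

namespace Digraph

variable {V : Type*} [Fintype V]

/-- The out-neighbours of `x` in `A`. -/
noncomputable def outFinset (D : Digraph V) (A : Set V) (x : V) : Finset A := {y | D.Adj x y}

@[simp] lemma mem_outFinset {D : Digraph V} {A : Set V} {x : V} {y : A} :
    y ∈ D.outFinset A x ↔ D.Adj x y := by simp [outFinset]

end Digraph

namespace SimpleGraph

variable {V : Type*}

lemma adj_iff_of_restrict_eq {D E : Digraph V} {A : Set V}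
    (h : D.restrict A = E.restrict A) {x y : V} (hx : x ∈ A) (hy : y ∈ A) :
    D.Adj x y ↔ E.Adj x y := by
  have := congrArg (fun F : Digraph A => F.Adj ⟨x, hx⟩ ⟨y, hy⟩) h
  simpa using this

lemma ne_of_coe_compl {u v : V} (a : ({u, v}ᶜ : Set V)) : (a : V) ≠ u ∧ (a : V) ≠ v := by
  have h := a.2
  rw [Set.mem_compl_iff, Set.mem_insert_iff, Set.mem_singleton_iff, not_or] at h
  exact h

lemma exists_coe_of_ne {u v a : V} (hu : a ≠ u) (hv : a ≠ v) :
    ∃ b : ({u, v}ᶜ : Set V), (b : V) = a := ⟨⟨a, by simp [hu, hv]⟩, rfl⟩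

variable [Fintype V]

/-- The neighbours of `x` in `A`. -/
noncomputable def nbrFinset (G : SimpleGraph V) (A : Set V) (x : V) : Finset A := {y | G.Adj x y}

@[simp] lemma mem_nbrFinset {G : SimpleGraph V} {A : Set V} {x : V} {y : A} :
    y ∈ G.nbrFinset A x ↔ G.Adj x y := by simp [nbrFinset]

/-- If `x → a → b` and `b` is a neighbour of `x`, then `b → x` would close a cyclic triangle. -/
lemma outFinset_mem_closedSubsets {G : SimpleGraph V} {D : Digraph V}
    (h : D ∈ G.acyclicOrientations) (A : Set V) (x : V) :
    D.outFinset A x ∈ (D.restrict A).closedSubsets (G.nbrFinset A x) := by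
  rw [mem_acyclicOrientations] at h
  rw [Digraph.mem_closedSubsets]
  refine ⟨fun y hy => ?_, fun a ha b hb hab => ?_⟩
  · rw [Digraph.mem_outFinset] at hy
    exact mem_nbrFinset.2 (h.1.adj_of_arc _ _ hy)
  · rw [Digraph.mem_outFinset] at ha ⊢
    rw [mem_nbrFinset] at hb
    exact (h.1.total hb).resolve_right (h.2 _ _ _ ha hab)

lemma adj_left_iff_of_outFinset_eq {G : SimpleGraph V} {D E : Digraph V}
    (hD : G.IsOrientation D) (hE : G.IsOrientation E) {A : Set V} {x : V}
    (h : D.outFinset A x = E.outFinset A x) {y : V} (hy : y ∈ A) :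
    (D.Adj x y ↔ E.Adj x y) ∧ (D.Adj y x ↔ E.Adj y x) := by
  have h1 : D.Adj x y ↔ E.Adj x y := by
    simpa using Finset.ext_iff.1 h ⟨y, hy⟩
  refine ⟨h1, ?_⟩
  have a1 := (isOrientation_iff.1 hD).1 x y
  have a2 := (isOrientation_iff.1 hE).1 x y
  have b1 := (isOrientation_iff.1 hD).2 x y
  have b2 := (isOrientation_iff.1 hE).2 x y
  tauto

/-- Deleting a vertex whose edges can be oriented in at most `U` ways, whatever the orientation of
the other edges. -/
theorem numFreeOrientations_le_mul_of_closedSubsets_le (G : SimpleGraph V) (x : V) (U : ℕ)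
    (hU : ∀ D ∈ (G.induce {x}ᶜ).acyclicOrientations,
      #(D.closedSubsets (G.nbrFinset {x}ᶜ x)) ≤ U) :
    G.numFreeOrientations cyclicTriangle ≤
      U * (G.induce {x}ᶜ).numFreeOrientations cyclicTriangle := by
  rw [← card_acyclicOrientations, ← card_acyclicOrientations]
  refine card_le_mul_card_image_of_maps_to (f := fun D => D.restrict {x}ᶜ)
    (fun D hD => restrict_mem_acyclicOrientations hD _) U fun E hE => ?_
  refine le_trans (card_le_card_of_injOn (fun D => D.outFinset {x}ᶜ x) (fun D hD => ?_) ?_)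
    (hU E hE)
  · simp only [mem_coe, mem_filter] at hD ⊢
    rw [← hD.2]
    exact outFinset_mem_closedSubsets hD.1 _ _
  · intro D hD F hF hDF
    simp only [mem_coe, mem_filter] at hD hF
    have oD := (mem_acyclicOrientations.1 hD.1).1
    have oF := (mem_acyclicOrientations.1 hF.1).1
    ext a b
    by_cases ha : a = x
    · by_cases hb : b = x
      · subst ha hb
        exact iff_of_false (fun h => (oD.adj_of_arc _ _ h).ne rfl)
          (fun h => (oF.adj_of_arc _ _ h).ne rfl)
      · subst ha
        exact (adj_left_iff_of_outFinset_eq oD oF hDF hb).1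
    · by_cases hb : b = x
      · subst hb
        exact (adj_left_iff_of_outFinset_eq oD oF hDF ha).2
      · exact adj_iff_of_restrict_eq (hD.2.trans hF.2.symm) ha hb

/-- If `x` is joined to everything, splitting by the set `S` of its out-neighbours leaves no choice
for the edges between `S` and its complement. -/
theorem numFreeOrientations_le_sum_of_dominating (G : SimpleGraph V) (x : V)
    (hx : ∀ y, y ≠ x → G.Adj x y) :
    G.numFreeOrientations cyclicTriangle ≤ ∑ S ∈ (univ.erase x).powerset,
      (G.induce (S : Set V)).numFreeOrientations cyclicTriangle *
      (G.induce ((univ.erase x \ S : Finset V) : Set V)).numFreeOrientations cyclicTriangle := by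
  simp only [← card_acyclicOrientations]
  rw [card_eq_sum_card_fiberwise (f := fun D : Digraph V => ({y | D.Adj x y} : Finset V))
    (t := (univ.erase x).powerset)]
  · refine sum_le_sum fun S hS => ?_
    rw [← card_product]
    refine card_le_card_of_injOn (fun D => (D.restrict _, D.restrict _)) (fun D hD => ?_) ?_
    · simp only [mem_coe, mem_filter] at hD
      exact mem_product.2 ⟨restrict_mem_acyclicOrientations hD.1 _,
        restrict_mem_acyclicOrientations hD.1 _⟩
    · intro D hD F hF hDF
      simp only [mem_coe, mem_filter, mem_acyclicOrientations] at hD hF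
      obtain ⟨⟨oD, tD⟩, rfl⟩ := hD
      obtain ⟨⟨oF, tF⟩, hS'⟩ := hF
      simp only [Prod.mk.injEq] at hDF
      have hout : ∀ y, F.Adj x y ↔ D.Adj x y := fun y => by
        simpa using Finset.ext_iff.1 hS' y
      have hin : ∀ y, F.Adj y x ↔ D.Adj y x := fun y => by
        have a1 := (isOrientation_iff.1 oD).1 x y
        have a2 := (isOrientation_iff.1 oF).1 x y
        have b1 := (isOrientation_iff.1 oD).2 x y
        have b2 := (isOrientation_iff.1 oF).2 x y
        have := hout y
        tauto
      -- From `x → a` and `b → x`, an arc `a → b` would close a cycle, so any edge between them is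
      -- `b → a` in both orientations.
      have cross : ∀ a b, D.Adj x a → b ≠ x → ¬ D.Adj x b →
          (D.Adj a b ↔ F.Adj a b) ∧ (D.Adj b a ↔ F.Adj b a) := by
        intro a b ha hbx hb
        have hb' : D.Adj b x := (oD.total (hx b hbx)).resolve_left hb
        have n1 := tD x a b ha
        have n2 := tF x a b ((hout a).2 ha)
        have hb'' := (hin b).2 hb'
        have a1 := (isOrientation_iff.1 oD).1 a b
        have a2 := (isOrientation_iff.1 oF).1 a b
        tauto
      ext a b
      by_cases ha : a = x
      · subst ha; exact (hout b).symm
      by_cases hb : b = x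
      · subst hb; exact (hin a).symm
      by_cases ha' : D.Adj x a <;> by_cases hb' : D.Adj x b
      · exact adj_iff_of_restrict_eq hDF.1 (by simpa using ha') (by simpa using hb')
      · exact (cross a b ha' hb hb').1
      · exact (cross b a hb' ha ha').2
      · exact adj_iff_of_restrict_eq hDF.2 (by simp [ha, ha']) (by simp [hb, hb'])
  · intro D hD
    have hD' := (mem_acyclicOrientations.1 hD).1
    simp only [coe_powerset, Set.mem_preimage, Set.mem_powerset_iff, coe_subset]
    intro y hy
    simp only [mem_filter, mem_univ, true_and] at hy
    simpa using (hD'.adj_of_arc _ _ hy).ne'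

/-- The extension of an orientation by two vertices `u` and `v` with prescribed out-neighbours. -/
def _root_.Digraph.extendTwo (u v : V) {A : Set V} (E : Digraph A) (Nu Nv S T : Finset A) :
    Digraph V where
  Adj a b := (∃ ha hb, E.Adj ⟨a, ha⟩ ⟨b, hb⟩) ∨
    (a = u ∧ ∃ hb, ⟨b, hb⟩ ∈ S) ∨ (b = u ∧ ∃ ha, ⟨a, ha⟩ ∈ Nu ∧ ⟨a, ha⟩ ∉ S) ∨
    (a = v ∧ ∃ hb, ⟨b, hb⟩ ∈ T) ∨ (b = v ∧ ∃ ha, ⟨a, ha⟩ ∈ Nv ∧ ⟨a, ha⟩ ∉ T)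

section extendTwo

variable {G : SimpleGraph V} {u v : V} {E : Digraph ({u, v}ᶜ : Set V)}
  {S T : Finset ({u, v}ᶜ : Set V)}

/-- A cyclic triangle through `u` would need an arc from `S` to a neighbour of `u` outside `S`;
likewise for `v` and `T`. No triangle contains both vertices, so the two choices do not interact. -/
lemma extendTwo_mem (huv : u ≠ v) (hadj : ¬ G.Adj u v)
    (hE : E ∈ (G.induce {u, v}ᶜ).acyclicOrientations)
    (hS : S ∈ E.closedSubsets (G.nbrFinset _ u)) (hT : T ∈ E.closedSubsets (G.nbrFinset _ v)) :
    let D := Digraph.extendTwo u v E (G.nbrFinset _ u) (G.nbrFinset _ v) S T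
    D ∈ G.acyclicOrientations ∧ D.restrict _ = E ∧ D.outFinset _ u = S ∧ D.outFinset _ v = T := by
  intro D
  rw [mem_acyclicOrientations] at hE
  rw [Digraph.mem_closedSubsets] at hS hT
  have d0 : ∀ a b : ({u, v}ᶜ : Set V), D.Adj a b ↔ E.Adj a b := by
    intro a b
    have := ne_of_coe_compl a
    have := ne_of_coe_compl b
    simp_all [D, Digraph.extendTwo]
  have d1 : ∀ b : ({u, v}ᶜ : Set V), D.Adj u b ↔ b ∈ S := by
    intro b
    have := ne_of_coe_compl b
    simp_all [D, Digraph.extendTwo]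
  have d2 : ∀ b : ({u, v}ᶜ : Set V), D.Adj b u ↔ G.Adj u b ∧ b ∉ S := by
    intro b
    have := ne_of_coe_compl b
    simp_all [D, Digraph.extendTwo]
  have d3 : ∀ b : ({u, v}ᶜ : Set V), D.Adj v b ↔ b ∈ T := by
    intro b
    have := ne_of_coe_compl b
    simp_all [D, Digraph.extendTwo, huv.symm]
  have d4 : ∀ b : ({u, v}ᶜ : Set V), D.Adj b v ↔ G.Adj v b ∧ b ∉ T := by
    intro b
    have := ne_of_coe_compl b
    simp_all [D, Digraph.extendTwo, huv.symm]
  have e1 : ¬ D.Adj u v ∧ ¬ D.Adj v u ∧ ¬ D.Adj u u ∧ ¬ D.Adj v v := by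
    simp [D, Digraph.extendTwo]
  refine ⟨?_, ?_, ?_, ?_⟩
  · rw [mem_acyclicOrientations, isOrientation_iff]
    have cases : ∀ a : V, u = a ∨ v = a ∨ ∃ b : ({u, v}ᶜ : Set V), (b : V) = a := by
      intro a
      by_cases h1 : u = a
      · exact .inl h1
      by_cases h2 : v = a
      · exact .inr (.inl h2)
      exact .inr (.inr (exists_coe_of_ne (Ne.symm h1) (Ne.symm h2)))
    have iE := isOrientation_iff.1 hE.1
    have gA : ∀ a b : ({u, v}ᶜ : Set V), G.Adj a b ↔ E.Adj a b ∨ E.Adj b a := fun a b => iE.1 a b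
    have gu : ∀ b : ({u, v}ᶜ : Set V), G.Adj u b ↔ b ∈ S ∨ (G.Adj u b ∧ b ∉ S) := fun b => by
      have : b ∈ S → G.Adj u b := fun hb => mem_nbrFinset.1 (hS.1 hb)
      clear * - this; tauto
    have gv : ∀ b : ({u, v}ᶜ : Set V), G.Adj v b ↔ b ∈ T ∨ (G.Adj v b ∧ b ∉ T) := fun b => by
      have : b ∈ T → G.Adj v b := fun hb => mem_nbrFinset.1 (hT.1 hb)
      clear * - this; tauto
    have tu : ∀ b c, b ∈ S → E.Adj b c → ¬ (G.Adj u c ∧ c ∉ S) :=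
      fun b c hb hbc hc => hc.2 (hS.2 b hb c (mem_nbrFinset.2 hc.1) hbc)
    have tv : ∀ b c, b ∈ T → E.Adj b c → ¬ (G.Adj v c ∧ c ∉ T) :=
      fun b c hb hbc hc => hc.2 (hT.2 b hb c (mem_nbrFinset.2 hc.1) hbc)
    refine ⟨⟨fun a b => ?_, fun a b => ?_⟩, fun a b c => ?_⟩
    · rcases cases a with rfl | rfl | ⟨a, rfl⟩ <;> rcases cases b with rfl | rfl | ⟨b, rfl⟩ <;>
        simp only [d0, d1, d2, d3, d4, e1]
      · simp
      · simpa using hadj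
      · exact gu b
      · simpa [G.adj_comm] using hadj
      · simp
      · exact gv b
      · rw [G.adj_comm, or_comm]; exact gu a
      · rw [G.adj_comm, or_comm]; exact gv a
      · exact gA a b
    · rcases cases a with rfl | rfl | ⟨a, rfl⟩ <;> rcases cases b with rfl | rfl | ⟨b, rfl⟩ <;>
        simp only [d0, d1, d2, d3, d4, e1] <;>
        first | exact iE.2 a b | exact fun h => h.elim | exact fun h h' => h'.2 h |
          exact fun h h' => h.2 h'
    · rcases cases a with rfl | rfl | ⟨a, rfl⟩ <;> rcases cases b with rfl | rfl | ⟨b, rfl⟩ <;>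
        rcases cases c with rfl | rfl | ⟨c, rfl⟩ <;>
        simp only [d0, d1, d2, d3, d4, e1] <;>
        first
        | exact hE.2 a b c
        | exact tu b c
        | exact tv b c
        | exact fun h1 h2 h3 => tu c a h2 h3 h1
        | exact fun h1 h2 h3 => tv c a h2 h3 h1
        | exact fun h1 h2 h3 => tu a b h3 h1 h2
        | exact fun h1 h2 h3 => tv a b h3 h1 h2
        | exact fun h1 h2 h3 => h1
        | exact fun h1 h2 h3 => h2
        | exact fun h1 h2 h3 => h3
  · ext a b; simp [d0]
  · ext a; simp [d1]
  · ext a; simp [d3]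

/-- The equations for `H`, `Nu`, `Nv` let one formula apply to a graph and to both of its clonings,
which share the induced graph and hence the index set of the sum. -/
lemma numFreeOrientations_eq_sum (huv : u ≠ v) (hadj : ¬ G.Adj u v)
    {H : SimpleGraph ({u, v}ᶜ : Set V)} (hH : G.induce _ = H)
    {Nu Nv : Finset ({u, v}ᶜ : Set V)} (hu : G.nbrFinset _ u = Nu) (hv : G.nbrFinset _ v = Nv) :
    G.numFreeOrientations cyclicTriangle =
      ∑ E ∈ H.acyclicOrientations, #(E.closedSubsets Nu) * #(E.closedSubsets Nv) := by
  subst hH hu hv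
  rw [← card_acyclicOrientations, card_eq_sum_card_fiberwise
    (f := fun D : Digraph V => D.restrict {u, v}ᶜ)
    (fun D hD => restrict_mem_acyclicOrientations hD _)]
  refine sum_congr rfl fun E hE => ?_
  rw [← card_product]
  refine card_bij (fun D _ => (D.outFinset _ u, D.outFinset _ v)) ?_ ?_ ?_
  · intro D hDE
    obtain ⟨hD, rfl⟩ := mem_filter.1 hDE
    exact mem_product.2 ⟨outFinset_mem_closedSubsets hD _ u, outFinset_mem_closedSubsets hD _ v⟩
  · intro D hDE F hFE hDF
    obtain ⟨hD, rfl⟩ := mem_filter.1 hDE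
    obtain ⟨hF, hDF'⟩ := mem_filter.1 hFE
    have oD := (mem_acyclicOrientations.1 hD).1
    have oF := (mem_acyclicOrientations.1 hF).1
    obtain ⟨h1, h2⟩ := Prod.mk.inj hDF
    have cases : ∀ a : V, u = a ∨ v = a ∨ a ∈ ({u, v}ᶜ : Set V) := by
      intro a
      by_cases h1 : u = a
      · exact .inl h1
      by_cases h2 : v = a
      · exact .inr (.inl h2)
      · exact .inr (.inr (by simp [Ne.symm h1, Ne.symm h2]))
    have none : ∀ a b, ¬ G.Adj a b → (D.Adj a b ↔ F.Adj a b) := fun a b hab =>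
      iff_of_false (fun h => hab (oD.adj_of_arc _ _ h)) (fun h => hab (oF.adj_of_arc _ _ h))
    ext a b
    rcases cases a with rfl | rfl | ha <;> rcases cases b with rfl | rfl | hb
    · exact none _ _ (G.irrefl)
    · exact none _ _ hadj
    · exact (adj_left_iff_of_outFinset_eq oD oF h1 hb).1
    · exact none _ _ (fun h => hadj h.symm)
    · exact none _ _ (G.irrefl)
    · exact (adj_left_iff_of_outFinset_eq oD oF h2 hb).1
    · exact (adj_left_iff_of_outFinset_eq oD oF h1 ha).2
    · exact (adj_left_iff_of_outFinset_eq oD oF h2 ha).2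
    · exact (adj_iff_of_restrict_eq hDF' ha hb).symm
  · rintro ⟨S, T⟩ hST
    obtain ⟨hS, hT⟩ := mem_product.1 hST
    obtain ⟨h1, h2, h3, h4⟩ := extendTwo_mem huv hadj hE hS hT
    exact ⟨_, mem_filter.2 ⟨h1, h2⟩, Prod.ext h3 h4⟩

end extendTwo

/-- Cloning one of two non-adjacent vertices in place of the other: on average over the two choices
the number of orientations does not drop. -/
theorem two_mul_numFreeOrientations_le (G : SimpleGraph V) {u v : V} (huv : u ≠ v)
    (hadj : ¬ G.Adj u v) :
    2 * G.numFreeOrientations cyclicTriangle ≤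
      (G.replaceVertex u v).numFreeOrientations cyclicTriangle +
      (G.replaceVertex v u).numFreeOrientations cyclicTriangle := by
  have hadj' : ¬ G.Adj v u := fun h => hadj h.symm
  rw [numFreeOrientations_eq_sum huv hadj rfl rfl rfl,
    numFreeOrientations_eq_sum (G := G.replaceVertex u v) (H := G.induce _)
      (Nu := G.nbrFinset _ u) (Nv := G.nbrFinset _ u) huv,
    numFreeOrientations_eq_sum (G := G.replaceVertex v u) (H := G.induce _)
      (Nu := G.nbrFinset _ v) (Nv := G.nbrFinset _ v) huv, mul_sum, ← sum_add_distrib]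
  · refine sum_le_sum fun E _ => ?_
    have := two_mul_le_add_sq (#(E.closedSubsets (G.nbrFinset _ u)))
      (#(E.closedSubsets (G.nbrFinset _ v)))
    nlinarith
  · simp [replaceVertex]
  · ext a b
    have := ne_of_coe_compl a
    have := ne_of_coe_compl b
    simp_all [replaceVertex]
  · ext a
    have := ne_of_coe_compl a
    simp_all [replaceVertex]
  · ext a
    have := ne_of_coe_compl a
    simp_all [replaceVertex]
  · simp [replaceVertex]
  · ext a b
    have := ne_of_coe_compl a
    have := ne_of_coe_compl b
    simp_all [replaceVertex]
  · ext a
    have := ne_of_coe_compl a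
    simp_all [replaceVertex]
  · ext a
    have := ne_of_coe_compl a
    simp_all [replaceVertex]

end SimpleGraph

/-! ### Symmetrization through twin classes. -/

namespace SimpleGraph

variable {V : Type*}

/-- Twins: vertices with the same neighbours. -/
def IsTwin (G : SimpleGraph V) (u v : V) : Prop := ∀ w, G.Adj u w ↔ G.Adj v w

lemma IsTwin.refl (G : SimpleGraph V) (u : V) : G.IsTwin u u := fun _ => Iff.rfl

lemma IsTwin.symm {G : SimpleGraph V} {u v : V} (h : G.IsTwin u v) : G.IsTwin v u :=
  fun w => (h w).symm

lemma IsTwin.trans {G : SimpleGraph V} {u v w : V} (h : G.IsTwin u v) (h' : G.IsTwin v w) :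
    G.IsTwin u w := fun x => (h x).trans (h' x)

lemma IsTwin.not_adj {G : SimpleGraph V} {u v : V} (h : G.IsTwin u v) : ¬ G.Adj u v :=
  fun h' => G.irrefl ((h v).1 h')

/-- Cloning `u` in place of `v` keeps all twin pairs that do not involve `v`. -/
lemma IsTwin.replaceVertex {G : SimpleGraph V} {u v a b : V} (h : G.IsTwin a b)
    (ha : a ≠ v) (hb : b ≠ v) : (G.replaceVertex u v).IsTwin a b := by
  intro w
  by_cases hw : w = v
  · subst hw
    have := h u
    simp_all [SimpleGraph.replaceVertex]
  · simp [SimpleGraph.replaceVertex, ha, hb, hw, h w]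

lemma isTwin_replaceVertex {G : SimpleGraph V} {u v : V} (huv : ¬ G.Adj u v) :
    (G.replaceVertex u v).IsTwin u v := by
  intro w
  by_cases hu : u = v
  · subst hu; rfl
  by_cases hw : w = v
  · subst hw; simp [SimpleGraph.replaceVertex]
  · simp [SimpleGraph.replaceVertex, hu, hw]

lemma IsClique.replaceVertex {G : SimpleGraph V} {T : Set V} (hT : G.IsClique T) {u v : V}
    (hv : v ∉ T) : (G.replaceVertex u v).IsClique T := by
  intro a ha b hb hab
  rw [adj_replaceVertex_iff_of_ne _ _ (by rintro rfl; exact hv ha) (by rintro rfl; exact hv hb)]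
  exact hT ha hb hab

variable [Fintype V]

/-- The total weight of the twins of `u`. -/
noncomputable def twinWeight (G : SimpleGraph V) (w : V → ℕ) (u : V) : ℕ :=
  ∑ x with G.IsTwin u x, w x

/-- The sum of the squares of the weights of the twin classes. -/
noncomputable def twinEnergy (G : SimpleGraph V) (w : V → ℕ) : ℕ :=
  ∑ u, w u * G.twinWeight w u

/-- Moving weight `w v` from a class of total `Q` to one of total `P ≥ Q` raises the sum of squares
by `2 * w v * (P - Q) + 2 * w v ^ 2`; twin pairs avoiding `v` are never lost. -/
lemma twinEnergy_lt_replaceVertex (G : SimpleGraph V) (w : V → ℕ) {u v : V}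
    (hadj : ¬ G.Adj u v) (htwin : ¬ G.IsTwin u v) (hw : 0 < w v)
    (hle : G.twinWeight w v ≤ G.twinWeight w u) :
    G.twinEnergy w < (G.replaceVertex u v).twinEnergy w := by
  set G' := G.replaceVertex u v
  have huv : u ≠ v := fun h => htwin (h ▸ IsTwin.refl _ _)
  set P := G.twinWeight w u
  set Q := G.twinWeight w v
  -- the class of `v` in the new graph
  have hv' : w v + P ≤ G'.twinWeight w v := by
    have hnot : v ∉ ({x | G.IsTwin u x} : Finset V) := by simpa using htwin
    rw [show w v + P = ∑ x ∈ insert v ({x | G.IsTwin u x} : Finset V), w x from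
      (sum_insert hnot).symm]
    refine sum_le_sum_of_subset fun x hx => ?_
    simp only [mem_insert, mem_filter, mem_univ, true_and] at hx ⊢
    rcases hx with rfl | hx
    · exact IsTwin.refl _ _
    · exact (isTwin_replaceVertex hadj).symm.trans
        (hx.replaceVertex huv (by rintro rfl; exact htwin hx))
  -- The contribution of `v` stands on the opposite side, which avoids truncated subtraction.
  have hx : ∀ x, x ≠ v → G.twinWeight w x + (if G'.IsTwin x v then w v else 0) ≤
      G'.twinWeight w x + (if G.IsTwin x v then w v else 0) := by
    intro x hxv
    have split : ∀ H : SimpleGraph V, H.twinWeight w x =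
        (if H.IsTwin x v then w v else 0) + ∑ y ∈ univ.erase v with H.IsTwin x y, w y := by
      intro H
      rw [twinWeight, sum_filter, sum_filter]
      exact (add_sum_erase _ (fun y => if H.IsTwin x y then w y else 0) (mem_univ v)).symm
    have : ∑ y ∈ univ.erase v with G.IsTwin x y, w y ≤
        ∑ y ∈ univ.erase v with G'.IsTwin x y, w y := by
      refine sum_le_sum_of_subset fun y hy => ?_
      simp only [mem_filter, mem_erase, mem_univ, and_true] at hy ⊢
      exact ⟨hy.1, hy.2.replaceVertex hxv hy.1⟩
    rw [split G, split G']
    omega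
  have tot : ∀ H : SimpleGraph V, ∑ x ∈ univ.erase v, w x * (if H.IsTwin x v then w v else 0) =
      w v * H.twinWeight w v - w v * w v := by
    intro H
    refine eq_tsub_of_add_eq ?_
    have : w v * w v = w v * (if H.IsTwin v v then w v else 0) := by simp [IsTwin.refl]
    rw [this, add_comm, add_sum_erase univ (fun x => w x * (if H.IsTwin x v then w v else 0))
      (mem_univ v), twinWeight, sum_filter, mul_sum]
    refine sum_congr rfl fun x _ => ?_
    have : H.IsTwin x v ↔ H.IsTwin v x := ⟨IsTwin.symm, IsTwin.symm⟩
    simp only [this]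
    split_ifs <;> ring
  have hsum := sum_le_sum (s := univ.erase v) fun x hx' =>
    Nat.mul_le_mul_left (w x) (hx x (ne_of_mem_erase hx'))
  simp only [mul_add, sum_add_distrib, tot] at hsum
  have hQ : w v ≤ Q := single_le_sum (f := w) (fun _ _ => Nat.zero_le _)
    (by simp [IsTwin.refl])
  have e : ∀ H : SimpleGraph V, H.twinEnergy w =
      w v * H.twinWeight w v + ∑ x ∈ univ.erase v, w x * H.twinWeight w x := fun H =>
    (add_sum_erase _ _ (mem_univ v)).symm
  rw [e G, e G']
  have h1 : w v * w v ≤ w v * Q := Nat.mul_le_mul_left _ hQ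
  have h2 : w v * (w v + Q) ≤ w v * G'.twinWeight w v :=
    Nat.mul_le_mul_left _ (by omega)
  have h3 : 0 < w v * w v := Nat.mul_pos hw hw
  rw [mul_add] at h2
  rw [show G.twinWeight w v = Q from rfl] at hsum ⊢
  omega

/-- Symmetrization: a graph with the most orientations can be replaced by a complete multipartite
one, while keeping a given clique. -/
theorem exists_multipartite_of_forall_le (G : SimpleGraph V)
    (hG : ∀ H : SimpleGraph V,
      H.numFreeOrientations cyclicTriangle ≤ G.numFreeOrientations cyclicTriangle)
    {T : Finset V} (hT : G.IsClique T) :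
    ∃ H : SimpleGraph V, H.numFreeOrientations cyclicTriangle =
      G.numFreeOrientations cyclicTriangle ∧ H.IsClique T ∧
      ∀ u v w, ¬ H.Adj u v → ¬ H.Adj v w → ¬ H.Adj u w := by
  -- With these weights a class meeting `T` outweighs every class disjoint from `T`.
  let w : V → ℕ := fun x => if x ∈ T then Fintype.card V + 1 else 1
  have hw : ∀ x, 0 < w x := fun x => by simp only [w]; split_ifs <;> omega
  obtain ⟨H, hH, hmax⟩ := exists_max_image
    (univ.filter fun H : SimpleGraph V => H.numFreeOrientations cyclicTriangle =
      G.numFreeOrientations cyclicTriangle ∧ H.IsClique T) (fun H => H.twinEnergy w)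
    ⟨G, by simp [hT]⟩
  simp only [mem_filter, mem_univ, true_and] at hH hmax
  -- Cloning `u` over `v ∉ T` keeps the clique, and keeps the count because neither cloning can
  -- exceed the maximum; so the energy must not increase.
  have step : ∀ u v, ¬ H.Adj u v → ¬ H.IsTwin u v → v ∉ T →
      H.twinWeight w u < H.twinWeight w v := by
    intro u v hadj htwin hv
    by_contra! hle
    have huv : u ≠ v := fun h => htwin (h ▸ IsTwin.refl _ _)
    refine absurd (hmax (H.replaceVertex u v) ⟨?_, hH.2.replaceVertex hv⟩)
      (twinEnergy_lt_replaceVertex H w hadj htwin (hw v) hle).not_ge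
    have := two_mul_numFreeOrientations_le H huv hadj
    have := hG (H.replaceVertex u v)
    have := hG (H.replaceVertex v u)
    omega
  -- The class of `u` avoids `T`: a twin of `u` in `T` would be adjacent to `v`, and then so would
  -- `u`.
  have big : ∀ u v, ¬ H.Adj u v → ¬ H.IsTwin u v → v ∈ T →
      H.twinWeight w u < H.twinWeight w v := by
    intro u v hadj htwin hv
    have h1 : H.twinWeight w u = ∑ x with H.IsTwin u x, 1 := by
      refine sum_congr rfl fun x hx => if_neg fun hxT => ?_
      have hux : H.IsTwin u x := by simpa using hx
      refine hadj ((hux v).2 (hH.2 hxT hv ?_))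
      rintro rfl
      exact htwin hux
    have h2 : w v ≤ H.twinWeight w v := single_le_sum (f := w) (fun _ _ => Nat.zero_le _)
      (by simp [IsTwin.refl])
    have h3 : w v = Fintype.card V + 1 := if_pos hv
    have h4 := card_filter_le (univ : Finset V) (fun x => H.IsTwin u x)
    rw [card_univ] at h4
    rw [← card_eq_sum_ones] at h1
    omega
  have all : ∀ u v, ¬ H.Adj u v → H.IsTwin u v := by
    intro u v hadj
    by_contra htwin
    have h1 : H.twinWeight w u < H.twinWeight w v := by
      by_cases hv : v ∈ T
      · exact big u v hadj htwin hv
      · exact step u v hadj htwin hv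
    have h2 : H.twinWeight w v < H.twinWeight w u := by
      have hadj' : ¬ H.Adj v u := fun h => hadj h.symm
      have htwin' : ¬ H.IsTwin v u := fun h => htwin h.symm
      by_cases hu : u ∈ T
      · exact big v u hadj' htwin' hu
      · exact step v u hadj' htwin' hu
    omega
  exact ⟨H, hH.1, hH.2, fun u v x huv hvx => ((all u v huv).trans (all v x hvx)).not_adj⟩

end SimpleGraph

/-! ### Numerical estimates for the inductive bound. -/

/-- An upper bound for the number of orientations of a graph on `n` vertices without cyclic
triangles. -/
def orientationBound : ℕ → ℕ
  | 0 => 1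
  | 1 => 1
  | 2 => 2
  | 3 => 6
  | 4 => 24
  | 5 => 120
  | 6 => 840
  | 7 => 5880
  | n + 8 => 2 ^ ((n + 8) ^ 2 / 4)

lemma orientationBound_of_le {n : ℕ} (hn : 8 ≤ n) : orientationBound n = 2 ^ (n ^ 2 / 4) := by
  obtain ⟨m, rfl⟩ := Nat.exists_eq_add_of_le' hn
  rfl

lemma orientationBound_pos (n : ℕ) : 0 < orientationBound n := by
  rcases lt_or_ge n 8 with h | h
  · interval_cases n <;> decide
  · rw [orientationBound_of_le h]; positivity

lemma two_pow_le_orientationBound (n : ℕ) : 2 ^ (n ^ 2 / 4) ≤ orientationBound n := by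
  rcases lt_or_ge n 8 with h | h
  · interval_cases n <;> decide
  · exact (orientationBound_of_le h).ge

lemma succ_sq_div_four (n : ℕ) : (n + 1) ^ 2 / 4 = n ^ 2 / 4 + (n + 1) / 2 := by
  rcases Nat.even_or_odd' n with ⟨k, rfl | rfl⟩
  · have h1 : (2 * k + 1) ^ 2 = 4 * (k ^ 2 + k) + 1 := by ring
    have h2 : (2 * k) ^ 2 = 4 * k ^ 2 := by ring
    omega
  · have h1 : (2 * k + 1 + 1) ^ 2 = 4 * (k ^ 2 + 2 * k + 1) := by ring
    have h2 : (2 * k + 1) ^ 2 = 4 * (k ^ 2 + k) + 1 := by ring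
    omega

/-- Beyond the table the exponents grow by `(n + 1) / 2`, which is nondecreasing. Log-convexity
makes unbalanced products the largest. -/
lemma orientationBound_logConvex (n : ℕ) :
    orientationBound (n + 1) * orientationBound (n + 1) ≤
      orientationBound n * orientationBound (n + 2) := by
  rcases lt_or_ge n 8 with h | h
  · interval_cases n <;> decide
  · rw [orientationBound_of_le h, orientationBound_of_le (by omega : 8 ≤ n + 1),
      orientationBound_of_le (by omega : 8 ≤ n + 2), ← pow_add, ← pow_add]
    refine Nat.pow_le_pow_right (by norm_num) ?_
    rw [show n + 2 = n + 1 + 1 from rfl, succ_sq_div_four (n + 1), succ_sq_div_four n]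
    omega

lemma orientationBound_succ_mul_le {i j : ℕ} (h : i ≤ j) :
    orientationBound (i + 1) * orientationBound j ≤
      orientationBound i * orientationBound (j + 1) := by
  induction j, h using Nat.le_induction with
  | base => exact (mul_comm _ _).le
  | succ j _ ih =>
    have h1 := orientationBound_logConvex j
    have h2 := orientationBound_pos j
    refine Nat.le_of_mul_le_mul_right (c := orientationBound j) ?_ h2
    calc orientationBound (i + 1) * orientationBound (j + 1) * orientationBound j
        = (orientationBound (i + 1) * orientationBound j) * orientationBound (j + 1) := by ring
      _ ≤ (orientationBound i * orientationBound (j + 1)) * orientationBound (j + 1) := by gcongr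
      _ = orientationBound i * (orientationBound (j + 1) * orientationBound (j + 1)) := by ring
      _ ≤ orientationBound i * (orientationBound j * orientationBound (j + 2)) := by gcongr
      _ = orientationBound i * orientationBound (j + 1 + 1) * orientationBound j := by ring

/-- Shifting units from the smaller index to the larger one ends at index `2`, where the value is
`2`. -/
lemma orientationBound_mul_le_two {i j : ℕ} (hi : 2 ≤ i) (hj : 2 ≤ j) :
    orientationBound i * orientationBound j ≤ 2 * orientationBound (i + j - 2) := by
  have main : ∀ k i j : ℕ, i = k + 2 → i ≤ j →
      orientationBound i * orientationBound j ≤ 2 * orientationBound (i + j - 2) := by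
    intro k
    induction k with
    | zero => rintro i j rfl _; simp [orientationBound]
    | succ k ih =>
      rintro i j rfl hij
      refine (orientationBound_succ_mul_le (by omega : k + 2 ≤ j)).trans ?_
      refine (ih (k + 2) (j + 1) rfl (by omega)).trans (le_of_eq ?_)
      congr 2
      omega
  rcases le_total i j with h | h
  · exact main (i - 2) i j (by omega) h
  · rw [mul_comm, add_comm i j]
    exact main (j - 2) j i (by omega) h

lemma sum_choose_mul_orientationBound_le {m : ℕ} (hm : 8 ≤ m) :
    ∑ i ∈ range (m + 1), m.choose i * (orientationBound i * orientationBound (m - i)) ≤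
      2 * orientationBound m + 2 * m * orientationBound (m - 1) +
        2 ^ m * (2 * orientationBound (m - 2)) := by
  -- The terms `0`, `1`, `m - 1`, `m` are kept exactly; the others share one bound, and their
  -- binomial coefficients sum to at most `2 ^ m`.
  have key : ∀ i ∈ range (m + 1), m.choose i * (orientationBound i * orientationBound (m - i)) ≤
      (if i = 0 then orientationBound m else 0) + (if i = m then orientationBound m else 0) +
      ((if i = 1 then m * orientationBound (m - 1) else 0) +
        (if i = m - 1 then m * orientationBound (m - 1) else 0)) +
      m.choose i * (2 * orientationBound (m - 2)) := by
    intro i hi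
    have hi' : i ≤ m := by simpa [Nat.lt_succ_iff] using hi
    by_cases h0 : i = 0
    · subst h0; simp [orientationBound]; omega
    by_cases h1 : i = m
    · subst h1; simp [orientationBound]; omega
    by_cases h2 : i = 1
    · subst h2; simp [orientationBound]; omega
    by_cases h3 : i = m - 1
    · subst h3
      rw [Nat.choose_symm (by omega : 1 ≤ m), show m - (m - 1) = 1 by omega]
      simp [orientationBound]; omega
    · refine le_trans (Nat.mul_le_mul_left _ (orientationBound_mul_le_two (by omega : 2 ≤ i)
        (by omega : 2 ≤ m - i))) ?_
      rw [show i + (m - i) - 2 = m - 2 by omega]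
      exact Nat.le_add_left _ _
  refine (sum_le_sum key).trans (le_of_eq ?_)
  rw [sum_add_distrib, sum_add_distrib, sum_add_distrib, sum_add_distrib, ← sum_mul,
    Nat.sum_range_choose]
  simp only [sum_ite_eq', mem_range]
  rw [if_pos (by omega), if_pos (by omega), if_pos (by omega), if_pos (by omega)]
  ring

theorem sum_choose_mul_orientationBound_lt {m : ℕ} (hm : 7 ≤ m) :
    ∑ i ∈ range (m + 1), m.choose i * (orientationBound i * orientationBound (m - i)) <
      2 ^ ((m + 1) ^ 2 / 4) := by
  obtain rfl | hm := hm.eq_or_lt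
  · decide
  refine (sum_choose_mul_orientationBound_le hm).trans_lt ?_
  rcases lt_or_ge m 10 with h | h
  · interval_cases m <;> decide
  · obtain ⟨k, rfl⟩ := Nat.exists_eq_add_of_le' h
    rw [orientationBound_of_le (by omega), orientationBound_of_le (by omega),
      orientationBound_of_le (by omega), show k + 10 - 1 = k + 9 by omega,
      show k + 10 - 2 = k + 8 by omega, succ_sq_div_four (k + 10), succ_sq_div_four (k + 9),
      succ_sq_div_four (k + 8)]
    generalize (k + 8) ^ 2 / 4 = x
    obtain ⟨p, hp⟩ : ∃ p, p = (k + 8 + 1) / 2 := ⟨_, rfl⟩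
    obtain ⟨q, hq⟩ : ∃ q, q = (k + 9 + 1) / 2 := ⟨_, rfl⟩
    obtain ⟨r, hr⟩ : ∃ r, r = (k + 10 + 1) / 2 := ⟨_, rfl⟩
    rw [← hp, ← hq, ← hr]
    -- Floors of halves of consecutive integers. Hence the three summands are at most `2`, `2` and
    -- `4` times `2 ^ (x + p + q)`, while `2 ^ r ≥ 16`.
    have hk : k + 10 = p + q + 1 := by omega
    have hlin : k + 10 ≤ 2 ^ q := by
      have : ∀ t, 2 * (t + 3) + 1 ≤ 2 ^ (t + 3) := by
        intro t
        induction t with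
        | zero => norm_num
        | succ t ih => rw [show t + 1 + 3 = t + 3 + 1 by ring, pow_succ]; omega
      have := this (q - 3)
      rw [show q - 3 + 3 = q by omega] at this
      omega
    have hr4 : 2 ^ 4 ≤ 2 ^ r := Nat.pow_le_pow_right (by norm_num) (by omega)
    have hpos : 0 < 2 ^ (x + p + q) := by positivity
    calc 2 * 2 ^ (x + p + q) + 2 * (k + 10) * 2 ^ (x + p) + 2 ^ (k + 10) * (2 * 2 ^ x)
        ≤ 2 * 2 ^ (x + p + q) + 2 * 2 ^ q * 2 ^ (x + p) + 2 ^ (k + 10) * (2 * 2 ^ x) := by gcongr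
      _ = 8 * 2 ^ (x + p + q) := by rw [hk]; ring
      _ < 2 ^ 4 * 2 ^ (x + p + q) := by omega
      _ ≤ 2 ^ r * 2 ^ (x + p + q) := by gcongr
      _ = 2 ^ (x + p + q + r) := by ring

theorem sum_choose_mul_orientationBound_le_succ (m : ℕ) :
    ∑ i ∈ range (m + 1), m.choose i * (orientationBound i * orientationBound (m - i)) ≤
      orientationBound (m + 1) := by
  rcases lt_or_ge m 7 with h | h
  · interval_cases m <;> decide
  · rw [orientationBound_of_le (by omega)]
    exact (sum_choose_mul_orientationBound_lt h).le

/-! ### Triangle-free graphs and Mantel's theorem. -/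

namespace SimpleGraph

universe u

variable {V : Type u} [Fintype V]

/-- Every orientation of a triangle-free graph is without cyclic triangles. -/
theorem numFreeOrientations_of_cliqueFree_three {G : SimpleGraph V} (hG : G.CliqueFree 3) :
    G.numFreeOrientations cyclicTriangle = 2 ^ #G.edgeFinset := by
  rw [← card_acyclicOrientations, ← card_powerset]
  -- A numbering of the vertices encodes an orientation as the set of edges directed upwards.
  let e := Fintype.equivFin V
  have hmem : ∀ (D : Digraph V) (a b : V), e a < e b →
      (s(a, b) ∈ {ε ∈ G.edgeFinset | ∃ u v, e u < e v ∧ s(u, v) = ε ∧ D.Adj u v} ↔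
        G.Adj a b ∧ D.Adj a b) := by
    intro D a b hab
    simp only [mem_filter, mem_edgeFinset, mem_edgeSet, Sym2.eq_iff]
    refine and_congr_right fun _ => ⟨?_, fun h => ⟨a, b, hab, .inl ⟨rfl, rfl⟩, h⟩⟩
    rintro ⟨u, v, huv, ⟨rfl, rfl⟩ | ⟨rfl, rfl⟩, h⟩
    · exact h
    · exact absurd huv hab.asymm
  refine card_bij
    (fun D _ => {ε ∈ G.edgeFinset | ∃ u v, e u < e v ∧ s(u, v) = ε ∧ D.Adj u v}) ?_ ?_ ?_
  · exact fun D _ => mem_powerset.2 (filter_subset _ _)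
  · intro D hD F hF hDF
    obtain ⟨oD, -⟩ := mem_acyclicOrientations.1 hD
    obtain ⟨oF, -⟩ := mem_acyclicOrientations.1 hF
    have up : ∀ a b, e a < e b → (D.Adj a b ↔ F.Adj a b) := by
      intro a b hab
      have h1 := hmem D a b hab
      rw [hDF, hmem F a b hab] at h1
      have := oD.adj_of_arc a b
      have := oF.adj_of_arc a b
      tauto
    ext a b
    rcases lt_trichotomy (e a) (e b) with h | h | h
    · exact up a b h
    · obtain rfl := e.injective h
      exact iff_of_false (fun h => (oD.adj_of_arc _ _ h).ne rfl)
        (fun h => (oF.adj_of_arc _ _ h).ne rfl)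
    · have h1 := up b a h
      have := (isOrientation_iff.1 oD).1 a b
      have := (isOrientation_iff.1 oF).1 a b
      have := (isOrientation_iff.1 oD).2 a b
      have := (isOrientation_iff.1 oF).2 a b
      tauto
  · intro S hS
    rw [mem_powerset] at hS
    have hS' : ∀ a b, s(a, b) ∈ S → G.Adj a b := fun a b h => by simpa using hS h
    let D : Digraph V := ⟨fun a b => G.Adj a b ∧ (e a < e b ↔ s(a, b) ∈ S)⟩
    have hD : ∀ a b, D.Adj a b ↔ G.Adj a b ∧ (e a < e b ↔ s(a, b) ∈ S) := fun _ _ => Iff.rfl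
    refine ⟨D, ?_, ?_⟩
    · rw [mem_acyclicOrientations, isOrientation_iff]
      have hlt : ∀ a b, G.Adj a b → (e a < e b ↔ ¬ e b < e a) := by
        intro a b hab
        have : e a ≠ e b := fun h => hab.ne (e.injective h)
        omega
      refine ⟨⟨fun a b => ?_, fun a b => ?_⟩, fun a b c hab hbc hca => ?_⟩
      · rw [hD, hD, G.adj_comm b a, Sym2.eq_swap (a := b)]
        have := hlt a b
        tauto
      · rw [hD, hD, G.adj_comm b a, Sym2.eq_swap (a := b)]
        have := hlt a b
        tauto
      · exact hG {a, b, c} (is3Clique_triple_iff.2 ⟨hab.1, hca.1.symm, hbc.1⟩)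
    · ext ε
      induction ε with
      | _ a b =>
      rcases lt_trichotomy (e a) (e b) with h | h | h
      · rw [hmem D a b h, hD]
        have := hS' a b
        tauto
      · obtain rfl := e.injective h
        refine iff_of_false (fun h => ?_) (fun h => (hS' _ _ h).ne rfl)
        simp at h
      · rw [Sym2.eq_swap, hmem D b a h, hD]
        have := hS' b a
        tauto

theorem card_edgeFinset_le_of_cliqueFree_three {G : SimpleGraph V} (hG : G.CliqueFree 3) :
    #G.edgeFinset ≤ Fintype.card V ^ 2 / 4 := by
  have h := CliqueFree.card_edgeFinset_le (r := 2) hG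
  refine h.trans ?_
  rcases Nat.mod_two_eq_zero_or_one (Fintype.card V) with h | h <;> simp [h]
  exact Nat.div_le_div_right (Nat.sub_le _ _)

theorem card_edgeFinset_turanGraph_two (n : ℕ) : #(turanGraph n 2).edgeFinset = n ^ 2 / 4 := by
  rw [card_edgeFinset_turanGraph]
  rcases Nat.even_or_odd' n with ⟨k, rfl | rfl⟩
  · simp
  · have h1 : (2 * k + 1) % 2 = 1 := by omega
    have h2 : (2 * k + 1) ^ 2 = 4 * (k ^ 2 + k) + 1 := by ring
    simp only [h1]
    rw [h2]
    simp
    omega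

/-- Triangle-free graphs with `n ^ 2 / 4` edges on `n` vertices are isomorphic. -/
theorem nonempty_iso_of_cliqueFree_three {W : Type*} [Fintype W] {G : SimpleGraph V}
    {H : SimpleGraph W} (hG : G.CliqueFree 3) (hH : H.CliqueFree 3)
    (hVW : Fintype.card V = Fintype.card W)
    (eG : #G.edgeFinset = Fintype.card V ^ 2 / 4) (eH : #H.edgeFinset = Fintype.card W ^ 2 / 4) :
    Nonempty (G ≃g H) := by
  have tG : G.IsTuranMaximal 2 := ⟨hG, fun K _ hK => by
    rw [eG]; convert card_edgeFinset_le_of_cliqueFree_three hK⟩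
  have tH : H.IsTuranMaximal 2 := ⟨hH, fun K _ hK => by
    rw [eH]; convert card_edgeFinset_le_of_cliqueFree_three hK⟩
  obtain ⟨f⟩ := tG.nonempty_iso_turanGraph
  obtain ⟨g⟩ := tH.nonempty_iso_turanGraph
  rw [← hVW] at g
  exact ⟨f.trans g.symm⟩

theorem cliqueFree_three_completeBipartiteGraph (V W : Type*) :
    (completeBipartiteGraph V W).CliqueFree 3 :=
  (CompleteBipartiteGraph.bicoloring V W).colorable.cliqueFree (by simp)

theorem card_edgeFinset_completeBipartiteGraph_half (n : ℕ) :
    #(completeBipartiteGraph (Fin (n / 2)) (Fin ((n + 1) / 2))).edgeFinset = n ^ 2 / 4 := by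
  have h := encard_edgeSet_completeBipartiteGraph (W₁ := Fin (n / 2)) (W₂ := Fin ((n + 1) / 2))
  rw [← coe_edgeFinset, Set.encard_coe_eq_coe_finsetCard] at h
  have h' : #(completeBipartiteGraph (Fin (n / 2)) (Fin ((n + 1) / 2))).edgeFinset =
      (n / 2) * ((n + 1) / 2) := by
    simp at h
    exact_mod_cast h
  rw [h']
  rcases Nat.even_or_odd' n with ⟨k, rfl | rfl⟩
  · rw [show 2 * k / 2 = k by omega, show (2 * k + 1) / 2 = k by omega]
    have : (2 * k) ^ 2 = 4 * (k * k) := by ring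
    omega
  · rw [show (2 * k + 1) / 2 = k by omega, show (2 * k + 1 + 1) / 2 = k + 1 by omega]
    have : (2 * k + 1) ^ 2 = 4 * (k * (k + 1)) + 1 := by ring
    omega

end SimpleGraph

/-! ### Arithmetic of part sizes. -/

section Parts

variable {ι : Type*}

/-- Here `a ≥ b i` and each other part has at least two elements, so the total is at least `2 * b i
+ 2 * (#s - 1)`. -/
lemma card_le_of_part_bounds {s : Finset ι} {b : ι → ℕ} {a : ℕ} (h2 : ∀ i ∈ s, 2 ≤ b i)
    (ha : ∀ i ∈ s, b i ≤ a) {i : ι} (hi : i ∈ s) :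
    b i + (#s - 1) ≤ (a + ∑ i ∈ s, b i) / 2 := by
  have h1 := add_sum_erase s b hi
  have h3 : #(s.erase i) • 2 ≤ ∑ j ∈ s.erase i, b j :=
    card_nsmul_le_sum _ _ _ fun j hj => h2 j (mem_of_mem_erase hj)
  rw [card_erase_of_mem hi, smul_eq_mul] at h3
  have := ha i hi
  omega

/-- Parts of size at least two, none of which is larger than a further part of size `a`. -/
lemma sum_two_pow_sub_one_lt {s : Finset ι} {b : ι → ℕ} {a : ℕ} (hs : 2 ≤ #s)
    (h2 : ∀ i ∈ s, 2 ≤ b i) (ha : ∀ i ∈ s, b i ≤ a) :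
    1 + ∑ i ∈ s, (2 ^ b i - 1) < 2 ^ ((a + ∑ i ∈ s, b i) / 2) := by
  set k := (a + ∑ i ∈ s, b i) / 2
  have h1 : ∑ i ∈ s, (2 ^ b i - 1) + #s = ∑ i ∈ s, 2 ^ b i := by
    rw [card_eq_sum_ones, ← sum_add_distrib]
    exact sum_congr rfl fun i _ => Nat.sub_add_cancel Nat.one_le_two_pow
  -- This uses `#s ≤ 2 ^ (#s - 1)`. It gives `∑ 2 ^ b i ≤ 2 ^ k`, and `#s ≥ 2` then makes the claim
  -- strict.
  have h3 : (∑ i ∈ s, 2 ^ b i) * 2 ^ (#s - 1) ≤ 2 ^ k * 2 ^ (#s - 1) := by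
    calc (∑ i ∈ s, 2 ^ b i) * 2 ^ (#s - 1) = ∑ i ∈ s, 2 ^ (b i + (#s - 1)) := by
          rw [sum_mul]; exact sum_congr rfl fun i _ => (pow_add _ _ _).symm
      _ ≤ ∑ _i ∈ s, 2 ^ k := sum_le_sum fun i hi =>
          Nat.pow_le_pow_right (by norm_num) (card_le_of_part_bounds h2 ha hi)
      _ = #s * 2 ^ k := by rw [sum_const, smul_eq_mul]
      _ ≤ 2 ^ (#s - 1) * 2 ^ k := by
          have := Nat.lt_two_pow_self (n := #s - 1)
          gcongr
          omega
      _ = 2 ^ k * 2 ^ (#s - 1) := mul_comm _ _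
  have h4 := Nat.le_of_mul_le_mul_right h3 (by positivity)
  omega

/-- The worst case is `a = 3` with parts `3` and `2`, giving `1 + 7 + 3`. -/
lemma sum_two_pow_sub_one_le_of_eight {s : Finset ι} {b : ι → ℕ} {a : ℕ} (hs : 2 ≤ #s)
    (h2 : ∀ i ∈ s, 2 ≤ b i) (ha : ∀ i ∈ s, b i ≤ a) (hn : a + ∑ i ∈ s, b i = 8) :
    1 + ∑ i ∈ s, (2 ^ b i - 1) ≤ 11 := by
  have hb : ∀ i ∈ s, b i + (#s - 1) ≤ 4 := fun i hi => by
    simpa [hn] using card_le_of_part_bounds h2 ha hi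
  obtain h | h := hs.eq_or_lt
  · obtain ⟨i, j, hij, rfl⟩ := card_eq_two.1 h.symm
    rw [sum_pair hij] at hn ⊢
    have i2 := h2 i (by simp)
    have j2 := h2 j (by simp)
    have ia := ha i (by simp)
    have ja := ha j (by simp)
    generalize b i = x at *
    generalize b j = y at *
    have hx : x ≤ 3 := by omega
    have hy : y ≤ 3 := by omega
    interval_cases x <;> interval_cases y <;> omega
  · obtain ⟨i, hi⟩ := card_pos.1 (by omega : 0 < #s)
    have hs3 : #s = 3 := by
      have := hb i hi
      have := h2 i hi
      omega
    have : ∑ i ∈ s, (2 ^ b i - 1) ≤ #s • 3 := sum_le_card_nsmul _ _ _ fun j hj => by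
      have h1 := hb j hj
      have h3 : b j = 2 := by
        have := h2 j hj
        omega
      norm_num [h3]
    rw [hs3] at this
    simp at this
    omega

end Parts

/-! ### Complete multipartite graphs with a triangle. -/

namespace SimpleGraph

universe u

variable {V : Type u}

lemma exists_adj_of_not_cliqueFree_three {G : SimpleGraph V} (h : ¬ G.CliqueFree 3) :
    ∃ p q r, G.Adj p q ∧ G.Adj p r ∧ G.Adj q r := by
  simp only [CliqueFree, not_forall, not_not] at h
  obtain ⟨s, hs⟩ := h
  obtain ⟨p, q, r, hpq, hpr, hqr, -⟩ := is3Clique_iff.1 hs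
  exact ⟨p, q, r, hpq, hpr, hqr⟩

variable [Fintype V]

/-- The non-neighbours of a vertex, including the vertex itself. -/
noncomputable def nonNeighbors (G : SimpleGraph V) (x : V) : Finset V := {y | ¬ G.Adj x y}

@[simp] lemma mem_nonNeighbors {G : SimpleGraph V} {x y : V} :
    y ∈ G.nonNeighbors x ↔ ¬ G.Adj x y := by simp [nonNeighbors]

section Multipartite

variable {G : SimpleGraph V} (htrans : ∀ u v w, ¬ G.Adj u v → ¬ G.Adj v w → ¬ G.Adj u w)

/-- The parts of a complete multipartite graph that do not contain `x`. -/
noncomputable def otherParts (G : SimpleGraph V) (x : V) : Finset (Finset V) :=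
  ({y | G.Adj x y} : Finset V).image G.nonNeighbors

lemma nonNeighbors_mem_otherParts {x y : V} (h : G.Adj x y) :
    G.nonNeighbors y ∈ G.otherParts x := mem_image_of_mem _ (by simpa using h)

lemma exists_of_mem_otherParts {x : V} {i : Finset V} (hi : i ∈ G.otherParts x) :
    ∃ y, G.Adj x y ∧ G.nonNeighbors y = i := by
  simpa [otherParts] using hi

include htrans

lemma nonNeighbors_eq_of_not_adj {a b : V} (h : ¬ G.Adj a b) :
    G.nonNeighbors a = G.nonNeighbors b := by
  ext y
  rw [mem_nonNeighbors, mem_nonNeighbors]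
  exact ⟨htrans b a y (fun h' => h h'.symm), htrans a b y h⟩

/-- The colour of a vertex is its part, given by `nonNeighbors`; colours outside `otherParts`
contribute zero. -/
lemma card_closedSubsets_nbrFinset_le {x : V} {D : Digraph ({x}ᶜ : Set V)}
    (hD : (G.induce {x}ᶜ).IsOrientation D) :
    #(D.closedSubsets (G.nbrFinset {x}ᶜ x)) ≤ 1 + ∑ i ∈ G.otherParts x, (2 ^ #i - 1) := by
  refine (D.card_closedSubsets_le (fun a => G.nonNeighbors a) _ fun a _ b _ hab => ?_).trans ?_
  · refine hD.total ?_
    by_contra h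
    exact hab (nonNeighbors_eq_of_not_adj htrans h)
  · refine Nat.add_le_add_left ?_ 1
    rw [← sum_subset (subset_univ (G.otherParts x))]
    · refine sum_le_sum fun i _ =>
        Nat.sub_le_sub_right (Nat.pow_le_pow_right two_pos ?_) 1
      refine card_le_card_of_injOn (fun a => (a : V)) (fun a ha => ?_)
        (Subtype.val_injective.injOn)
      simp only [mem_coe, mem_filter] at ha
      rw [← ha.2]
      simp
    · intro i _ hi
      refine Nat.sub_eq_zero_of_le (Nat.pow_le_pow_right (j := 0) two_pos ?_)
      rw [nonpos_iff_eq_zero, card_eq_zero, eq_empty_iff_forall_notMem]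
      intro a ha
      simp only [mem_filter] at ha
      exact hi (ha.2 ▸ nonNeighbors_mem_otherParts (mem_nbrFinset.1 ha.1))

lemma card_nonNeighbors_add_sum (x : V) :
    #(G.nonNeighbors x) + ∑ i ∈ G.otherParts x, #i = Fintype.card V := by
  have h1 : #({y | G.Adj x y} : Finset V) = ∑ i ∈ G.otherParts x, #i := by
    rw [card_eq_sum_card_image G.nonNeighbors]
    refine sum_congr rfl fun i hi => ?_
    obtain ⟨y, hy, rfl⟩ := exists_of_mem_otherParts hi
    congr 1
    ext z
    simp only [mem_filter, mem_univ, true_and, mem_nonNeighbors]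
    constructor
    · rintro ⟨-, h⟩
      rw [← mem_nonNeighbors, ← h]
      simp
    · intro h
      refine ⟨?_, (nonNeighbors_eq_of_not_adj htrans h).symm⟩
      by_contra hxz
      exact htrans x z y hxz (fun h' => h h'.symm) hy
  rw [← h1, add_comm, nonNeighbors, card_filter_add_card_filter_not, card_univ]

/-- At most one vertex of the triangle lies in the part of `x`; the other two lie in different
parts. -/
lemma two_le_card_otherParts {p q r : V} (hpq : G.Adj p q) (hpr : G.Adj p r) (hqr : G.Adj q r)
    (x : V) : 2 ≤ #(G.otherParts x) := by
  have main : ∀ y z, G.Adj x y → G.Adj x z → G.Adj y z → 2 ≤ #(G.otherParts x) := by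
    intro y z hy hz hyz
    refine one_lt_card.2 ⟨_, nonNeighbors_mem_otherParts hy, _, nonNeighbors_mem_otherParts hz, ?_⟩
    intro h
    have : z ∈ G.nonNeighbors y := by rw [h]; simp
    exact mem_nonNeighbors.1 this hyz
  have sep : ∀ y z, G.Adj y z → ¬ G.Adj x y → G.Adj x z := by
    intro y z hyz hxy
    by_contra hxz
    exact htrans y x z (fun h => hxy h.symm) hxz hyz
  by_cases hp : G.Adj x p
  · by_cases hq : G.Adj x q
    · exact main p q hp hq hpq
    · exact main p r hp (sep q r hqr hq) hpr
  · exact main q r (sep p q hpq hp) (sep p r hpr hp) hqr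

/-- The bound for complete multipartite graphs with a triangle, given the bound for graphs with
fewer vertices. -/
theorem numFreeOrientations_multipartite
    (ih : ∀ (W : Type u) [Fintype W] (H : SimpleGraph W), Fintype.card W < Fintype.card V →
      H.numFreeOrientations cyclicTriangle ≤ orientationBound (Fintype.card W))
    {p q r : V} (hpq : G.Adj p q) (hpr : G.Adj p r) (hqr : G.Adj q r) :
    G.numFreeOrientations cyclicTriangle ≤ orientationBound (Fintype.card V) ∧
      (8 ≤ Fintype.card V →
        G.numFreeOrientations cyclicTriangle < 2 ^ (Fintype.card V ^ 2 / 4)) := by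
  obtain ⟨m, hm⟩ : ∃ m, Fintype.card V = m + 1 :=
    Nat.exists_eq_succ_of_ne_zero (Fintype.card_pos_iff.2 ⟨p⟩).ne'
  by_cases hdom : ∃ x, ∀ y, y ≠ x → G.Adj x y
  · obtain ⟨x, hx⟩ := hdom
    have hcard : #(univ.erase x) = m := by
      rw [card_erase_of_mem (mem_univ x), card_univ, hm, Nat.add_sub_cancel]
    have cc : ∀ S : Finset V, Fintype.card (S : Set V) = #S := fun S => by simp
    have h : G.numFreeOrientations cyclicTriangle ≤
        ∑ i ∈ range (m + 1), m.choose i * (orientationBound i * orientationBound (m - i)) := by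
      refine (numFreeOrientations_le_sum_of_dominating G x hx).trans ?_
      refine (sum_le_sum (g := fun S => orientationBound #S * orientationBound (m - #S))
        fun S hS => ?_).trans (le_of_eq ?_)
      · have hS' := mem_powerset.1 hS
        have c1 := card_le_card hS'
        have c2 := card_sdiff_of_subset hS'
        rw [hcard] at c1 c2
        have e1 := ih (S : Set V) (G.induce (S : Set V)) (by rw [cc]; omega)
        have e2 := ih ((univ.erase x \ S : Finset V) : Set V) (G.induce _)
          (by rw [cc]; omega)
        rw [cc] at e1 e2
        rw [c2] at e2
        exact Nat.mul_le_mul e1 e2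
      · rw [sum_powerset_apply_card (fun i => orientationBound i * orientationBound (m - i)), hcard]
        simp only [smul_eq_mul]
    rw [hm]
    exact ⟨h.trans (sum_choose_mul_orientationBound_le_succ m),
      fun h8 => h.trans_lt (sum_choose_mul_orientationBound_lt (by omega))⟩
  · push Not at hdom
    have h2 : ∀ y, 2 ≤ #(G.nonNeighbors y) := by
      intro y
      obtain ⟨z, hz, hyz⟩ := hdom y
      exact one_lt_card.2 ⟨y, by simp, z, by simpa using hyz, hz.symm⟩
    -- The deleted vertex lies in a largest part, so that the remaining parts satisfy `b i ≤ a`.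
    obtain ⟨x, -, hx⟩ := exists_max_image univ (fun y => #(G.nonNeighbors y)) ⟨p, mem_univ p⟩
    have b2 : ∀ i ∈ G.otherParts x, 2 ≤ #i := by
      intro i hi
      obtain ⟨y, -, rfl⟩ := exists_of_mem_otherParts hi
      exact h2 y
    have ba : ∀ i ∈ G.otherParts x, #i ≤ #(G.nonNeighbors x) := by
      intro i hi
      obtain ⟨y, -, rfl⟩ := exists_of_mem_otherParts hi
      exact hx y (mem_univ y)
    have hs := two_le_card_otherParts htrans hpq hpr hqr x
    have htot := card_nonNeighbors_add_sum htrans x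
    have hU := sum_two_pow_sub_one_lt hs b2 ba
    have hU8 := sum_two_pow_sub_one_le_of_eight hs b2 ba
    rw [htot, hm] at hU
    have h6 : 6 ≤ m + 1 := by
      have h1 : #(G.otherParts x) • 2 ≤ ∑ i ∈ G.otherParts x, #i := card_nsmul_le_sum _ _ 2 b2
      have := h2 x
      rw [smul_eq_mul] at h1
      omega
    have hf := numFreeOrientations_le_mul_of_closedSubsets_le G x _ fun D hD =>
      card_closedSubsets_nbrFinset_le htrans (mem_acyclicOrientations.1 hD).1
    have hcard : Fintype.card ({x}ᶜ : Set V) = m := by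
      rw [Fintype.card_compl_set, hm]; simp
    have e := ih ({x}ᶜ : Set V) (G.induce _) (by omega)
    rw [hcard] at e
    have hf := hf.trans (Nat.mul_le_mul_left _ e)
    rw [htot, hm] at hU8
    rw [hm]
    generalize 1 + ∑ i ∈ G.otherParts x, (2 ^ #i - 1) = U at hf hU hU8
    have hlt : 8 ≤ m + 1 → G.numFreeOrientations cyclicTriangle < 2 ^ ((m + 1) ^ 2 / 4) := by
      intro h8
      -- Eight vertices need the sharper `U ≤ 11`: `11 * 5880 = 64680 < 2 ^ 16`, whereas `U ≤ 15`
      -- would not suffice.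
      obtain h | h := h8.eq_or_lt
      · obtain rfl : m = 7 := by omega
        have := hU8 rfl
        simp only [orientationBound] at hf
        norm_num
        omega
      · rw [orientationBound_of_le (by omega)] at hf
        rw [succ_sq_div_four, pow_add, mul_comm]
        exact hf.trans_lt (Nat.mul_lt_mul_of_pos_right hU (by positivity))
    refine ⟨?_, hlt⟩
    -- For six and seven vertices `hU` says `U ≤ 7`, the source of `840 = 7 * 120` and `5880 = 7 *
    -- 840`.
    rcases lt_or_ge m 7 with h | h
    · have h5 : 5 ≤ m := by omega
      interval_cases m
      · rw [show orientationBound 5 = 120 from rfl] at hf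
        rw [show orientationBound (5 + 1) = 840 from rfl]
        norm_num at hU
        omega
      · rw [show orientationBound 6 = 840 from rfl] at hf
        rw [show orientationBound (6 + 1) = 5880 from rfl]
        norm_num at hU
        omega
    · rw [orientationBound_of_le (by omega)]
      exact (hlt (by omega)).le

end Multipartite

/-! ### The general bound and the extremal graphs. -/

/-- A graph with a triangle and the most orientations can be taken to be complete multipartite. -/
lemma exists_multipartite_with_triangle {G : SimpleGraph V}
    (hG : ∀ H : SimpleGraph V,
      H.numFreeOrientations cyclicTriangle ≤ G.numFreeOrientations cyclicTriangle)
    (h : ¬ G.CliqueFree 3) :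
    ∃ H : SimpleGraph V, H.numFreeOrientations cyclicTriangle =
      G.numFreeOrientations cyclicTriangle ∧
      (∀ u v w, ¬ H.Adj u v → ¬ H.Adj v w → ¬ H.Adj u w) ∧
      ∃ p q r, H.Adj p q ∧ H.Adj p r ∧ H.Adj q r := by
  simp only [CliqueFree, not_forall, not_not] at h
  obtain ⟨s, hs⟩ := h
  obtain ⟨H, h1, h2, h3⟩ := exists_multipartite_of_forall_le G hG hs.isClique
  exact ⟨H, h1, h3, exists_adj_of_not_cliqueFree_three fun h => h s ⟨h2, hs.card_eq⟩⟩

theorem numFreeOrientations_le_orientationBound (G : SimpleGraph V) :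
    G.numFreeOrientations cyclicTriangle ≤ orientationBound (Fintype.card V) := by
  induction hn : Fintype.card V using Nat.strong_induction_on generalizing V with
  | _ n ih =>
  subst hn
  obtain ⟨M, -, hM⟩ := exists_max_image (univ : Finset (SimpleGraph V))
    (fun H => H.numFreeOrientations cyclicTriangle) ⟨G, mem_univ G⟩
  refine (hM G (mem_univ G)).trans ?_
  by_cases h : M.CliqueFree 3
  · rw [numFreeOrientations_of_cliqueFree_three h]
    exact (Nat.pow_le_pow_right (by norm_num) (card_edgeFinset_le_of_cliqueFree_three h)).trans
      (two_pow_le_orientationBound _)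
  · obtain ⟨H, h1, h2, p, q, r, hpq, hpr, hqr⟩ :=
      exists_multipartite_with_triangle (fun H => hM H (mem_univ H)) h
    rw [← h1]
    exact (numFreeOrientations_multipartite h2 (fun W _ H hW => ih _ hW H rfl) hpq hpr hqr).1

theorem numFreeOrientations_le_two_pow (hV : 8 ≤ Fintype.card V) (G : SimpleGraph V) :
    G.numFreeOrientations cyclicTriangle ≤ 2 ^ (Fintype.card V ^ 2 / 4) := by
  rw [← orientationBound_of_le hV]
  exact numFreeOrientations_le_orientationBound G

/-- An extremal graph with a triangle would symmetrize to a multipartite one with a triangle and the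
same count, against the strict bound. -/
theorem cliqueFree_three_of_numFreeOrientations_eq (hV : 8 ≤ Fintype.card V) {G : SimpleGraph V}
    (hG : G.numFreeOrientations cyclicTriangle = 2 ^ (Fintype.card V ^ 2 / 4)) :
    G.CliqueFree 3 := by
  by_contra h
  obtain ⟨H, h1, h2, p, q, r, hpq, hpr, hqr⟩ :=
    exists_multipartite_with_triangle
      (fun H => (numFreeOrientations_le_two_pow hV H).trans hG.ge) h
  have := (numFreeOrientations_multipartite h2
    (fun W _ H _ => numFreeOrientations_le_orientationBound H) hpq hpr hqr).2 hV
  omega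

theorem numFreeOrientations_eq_iff (hV : 8 ≤ Fintype.card V) (G : SimpleGraph V) :
    G.numFreeOrientations cyclicTriangle = 2 ^ (Fintype.card V ^ 2 / 4) ↔
      Nonempty (G ≃g completeBipartiteGraph (Fin (Fintype.card V / 2))
        (Fin ((Fintype.card V + 1) / 2))) := by
  have hK := cliqueFree_three_completeBipartiteGraph (Fin (Fintype.card V / 2))
    (Fin ((Fintype.card V + 1) / 2))
  have eK := card_edgeFinset_completeBipartiteGraph_half (Fintype.card V)
  constructor
  · intro h
    have hG := cliqueFree_three_of_numFreeOrientations_eq hV h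
    have hcard : Fintype.card (Fin (Fintype.card V / 2) ⊕ Fin ((Fintype.card V + 1) / 2)) =
        Fintype.card V := by
      rw [Fintype.card_sum, Fintype.card_fin, Fintype.card_fin]
      omega
    rw [numFreeOrientations_of_cliqueFree_three hG] at h
    refine nonempty_iso_of_cliqueFree_three hG hK hcard.symm
      (Nat.pow_right_injective le_rfl h) ?_
    rw [hcard]
    exact eK
  · rintro ⟨f⟩
    have hG : G.CliqueFree 3 := hK.comap f.isContained
    rw [numFreeOrientations_of_cliqueFree_three hG, f.card_edgeFinset_eq, eK]

end SimpleGraph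

theorem maxFreeOrientations_cyclicTriangle {n : ℕ} (hn : 8 ≤ n) :
    maxFreeOrientations n cyclicTriangle = 2 ^ (n ^ 2 / 4) := by
  refine le_antisymm (sup'_le _ _ fun G _ => ?_) ?_
  · simpa using SimpleGraph.numFreeOrientations_le_two_pow (by simpa using hn) G
  · refine le_trans (le_of_eq ?_) (le_sup' _ (mem_univ (SimpleGraph.turanGraph n 2)))
    rw [SimpleGraph.numFreeOrientations_of_cliqueFree_three
      (SimpleGraph.turanGraph_cliqueFree two_pos), ← SimpleGraph.card_edgeFinset_turanGraph_two n]
    congr!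

/-- The step from `n` to `n + 1` compares the factor `n + 1` with `2 ^ ((n + 1) / 2)`. -/
lemma factorial_le_two_pow {n : ℕ} (hn : 8 ≤ n) : n.factorial ≤ 2 ^ (n ^ 2 / 4) := by
  induction n, hn using Nat.le_induction with
  | base => decide
  | succ n hn ih =>
    rw [Nat.factorial_succ, succ_sq_div_four, pow_add, mul_comm]
    refine Nat.mul_le_mul ih ?_
    have : ∀ t, 2 * (t + 4) + 2 ≤ 2 ^ (t + 4) := by
      intro t
      induction t with
      | zero => norm_num
      | succ t ih => rw [show t + 1 + 4 = t + 4 + 1 by ring, pow_succ]; omega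
    have := this ((n + 1) / 2 - 4)
    rw [show (n + 1) / 2 - 4 + 4 = (n + 1) / 2 by omega] at this
    omega

theorem theorem1p3 (n : ℕ) (hn : 8 ≤ n) :
    maxFreeOrientations n cyclicTriangle = 2 ^ (n ^ 2 / 4) ∧
    (∀ (V : Type*) [Fintype V], Fintype.card V = n → ∀ G : SimpleGraph V,
      (G.numFreeOrientations cyclicTriangle = 2 ^ (n ^ 2 / 4) ↔
        Nonempty (G ≃g completeBipartiteGraph (Fin (n / 2)) (Fin ((n + 1) / 2))))) ∧
    maxFreeOrientations n cyclicTriangle = max (2 ^ (n ^ 2 / 4)) n.factorial := by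
  refine ⟨maxFreeOrientations_cyclicTriangle hn, ?_, ?_⟩
  · rintro V _ rfl G
    exact G.numFreeOrientations_eq_iff hn
  · rw [maxFreeOrientations_cyclicTriangle hn, max_eq_left (factorial_le_two_pow hn)]
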